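/- **Theorem 3.1.** Manifolds are smooth, Hausdorff, second countable, finite-dimensional and without boundary. A 2-form $\eta$ *tames* an almost-complex structure $J$ on a subspace $S\subset T_xX$ if $\eta(v,Jv)>0$ for all $0\neq v\in S$; it tames $J$ if this holds with $S=T_xX$ for every $x\in X$. Let $f:X\to Y$ be a smooth map between manifolds and let $C\subset X$ be a closed subset with $X-\operatorname{int}C$ compact, with an open neighborhood $W_C$ in $X$. Let $\omega_Y$ be a symplectic form on $Y$, and let $J$ be a continuous almost-complex structure on $X$ that is $(\omega_Y,f)$-tame, i.e. $f^*\omega_Y(v,Jv)>0$ for every $x\in X$ and every $v\in T_xX$ with $v\notin\ker df_x$. Fix a class $c\in H^2_{\mathrm{dR}}(X)$. Suppose that for each $y\in Y$ the fiber $f^{-1}(y)$ has an open neighborhood $W_y$ in $X$ containing $W_C$ such that the restriction $H^1_{\mathrm{dR}}(W_y)\to H^1_{\mathrm{dR}}(W_C)$ is surjective, together with a closed 2-form $\eta_y$ on $W_y$ such that $[\eta_y]=c|_{W_y}\in H^2_{\mathrm{dR}}(W_y)$ and such that $\eta_y$ tames $J$ on $\ker df_x$ for each $x\in W_y$. Suppose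 that the forms $\eta_y$ all restrict to the same closed form $\eta_C$ on $W_C$, and that $\eta_C$ tames $J$ on $T_xX$ for each $x\in C$. Then there is a closed 2-form $\eta$ on $X$ that agrees with $\eta_C$ on a neighborhood of $C$, with $[\eta]=c\in H^2_{\mathrm{dR}}(X)$, and there is $t_0>0$ such that for every $t$ with $0<t<t_0$ the form $\omega_t=t\eta+f^*\omega_Y$ tames $J$ and is symplectic. -/

import Mathlib

open Set Filter Topology TopologicalSpace
open scoped Manifold ContDiff

noncomputable section

namespace GeomForms

/-! ### Differential forms on open subsets of a manifold modelled on `E` -/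

section Forms

variable (E : Type*) [NormedAddCommGroup E] [NormedSpace ℝ E]
variable {X : Type*} [TopologicalSpace X] [ChartedSpace E X]

/-- A (not necessarily continuous) field of alternating `k`-forms on the tangent spaces of `X`. -/
abbrev FormField (X : Type*) [TopologicalSpace X] [ChartedSpace E X] (k : ℕ) :=
  (x : X) → (TangentSpace 𝓘(ℝ, E) x) [⋀^Fin k]→L[ℝ] ℝ

variable {E} {k : ℕ}

/-- The domain in `E` of the part of the chart around `x₀` that lies in `U`. -/
def chartDomain (U : Opens X) (x₀ : X) : Set E :=
  (extChartAt 𝓘(ℝ, E) x₀).target ∩ (extChartAt 𝓘(ℝ, E) x₀).symm ⁻¹' U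

/-- The expression of a field of `k`-forms in the chart around `x₀`: its pullback under the
inverse of that chart. -/
def chartRep (x₀ : X) (σ : FormField E X k) : E → E [⋀^Fin k]→L[ℝ] ℝ := fun v =>
  (σ ((extChartAt 𝓘(ℝ, E) x₀).symm v)).compContinuousLinearMap
    (mfderiv 𝓘(ℝ, E) 𝓘(ℝ, E) (extChartAt 𝓘(ℝ, E) x₀).symm v)

/-- The exterior derivative at `x`, computed in the chart around `x`. -/
def extDerivField (σ : FormField E X k) : FormField E X (k + 1) := fun x =>
  (extDeriv (chartRep x σ) (extChartAt 𝓘(ℝ, E) x x)).compContinuousLinearMap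
    (mfderiv 𝓘(ℝ, E) 𝓘(ℝ, E) (extChartAt 𝓘(ℝ, E) x) x)

/-- The fields of `k`-forms on `X` that are smooth on the open subset `U` and have the junk value `0`
at the points outside `U`. -/
def formSubmodule (k : ℕ) (U : Opens X) : Submodule ℝ (FormField E X k) where
  carrier := {σ | (∀ x₀ : X, ContDiffOn ℝ ∞ (chartRep x₀ σ) (chartDomain U x₀)) ∧
    ∀ x, x ∉ U → σ x = 0}
  zero_mem' := by
    refine ⟨fun x₀ => ?_, fun x _ => rfl⟩
    exact contDiffOn_const (c := (0 : E [⋀^Fin k]→L[ℝ] ℝ))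
  add_mem' := by
    rintro a b ⟨ha, ha'⟩ ⟨hb, hb'⟩
    refine ⟨fun x₀ => (ha x₀).add (hb x₀), fun x hx => ?_⟩
    simp [ha' x hx, hb' x hx]
  smul_mem' := by
    rintro c a ⟨ha, ha'⟩
    refine ⟨fun x₀ => (ha x₀).const_smul c, fun x hx => ?_⟩
    simp [ha' x hx]

variable (E) in
/-- The space `Ω^k(U)` of smooth `k`-forms on the open subset `U` of `X`. A form on `U` is recorded
as a field on `X` by giving it the value `0` at the points outside `U`. -/
def Form (k : ℕ) (U : Opens X) : Type _ := formSubmodule (E := E) k U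

instance (k : ℕ) (U : Opens X) : AddCommGroup (Form E k U) :=
  inferInstanceAs (AddCommGroup (formSubmodule (E := E) k U))

instance (k : ℕ) (U : Opens X) : Module ℝ (Form E k U) :=
  inferInstanceAs (Module ℝ (formSubmodule (E := E) k U))

/-- The underlying field on `X` of a form on `U` (with value `0` outside `U`). -/
def Form.toField {U : Opens X} (σ : Form E k U) : FormField E X k := Subtype.val σ

instance (U : Opens X) : CoeFun (Form E k U) (fun _ => FormField E X k) := ⟨Form.toField⟩

/-- Constructor for forms on `U`. -/
def Form.mk {U : Opens X} (σ : FormField E X k) (hσ : σ ∈ formSubmodule k U) : Form E k U :=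
  ⟨σ, hσ⟩

lemma Form.mem {U : Opens X} (σ : Form E k U) : σ.toField ∈ formSubmodule k U := Subtype.prop σ

lemma Form.ext {U : Opens X} {a b : Form E k U} (h : ∀ x, a x = b x) : a = b :=
  Subtype.ext (funext h)

@[simp] lemma Form.add_apply {U : Opens X} (a b : Form E k U) (x : X) :
    (a + b) x = a x + b x := rfl

@[simp] lemma Form.smul_apply {U : Opens X} (c : ℝ) (a : Form E k U) (x : X) :
    (c • a) x = c • a x := rfl

lemma isOpen_chartDomain (U : Opens X) (x₀ : X) : IsOpen (chartDomain (E := E) U x₀) :=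
  (continuousOn_extChartAt_symm x₀).isOpen_inter_preimage (isOpen_extChartAt_target x₀) U.isOpen

lemma mem_chartDomain_self {U : Opens X} {x : X} (hx : x ∈ U) :
    extChartAt 𝓘(ℝ, E) x x ∈ chartDomain U x :=
  ⟨mem_extChartAt_target x, by simpa using hx⟩

lemma chartRep_congr {U : Opens X} {σ σ' : FormField E X k} (h : ∀ x ∈ U, σ x = σ' x) (x₀ : X) :
    EqOn (chartRep x₀ σ) (chartRep x₀ σ') (chartDomain U x₀) := by
  intro v hv
  unfold chartRep
  rw [h _ hv.2]

lemma extDerivField_congr {U : Opens X} {σ σ' : FormField E X k} (h : ∀ x ∈ U, σ x = σ' x)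
    {x : X} (hx : x ∈ U) : extDerivField σ x = extDerivField σ' x := by
  unfold extDerivField
  rw [((chartRep_congr h x).eventuallyEq_of_mem
    ((isOpen_chartDomain U x).mem_nhds (mem_chartDomain_self hx))).extDeriv_eq]

lemma Form.differentiableAt {U : Opens X} {σ : FormField E X k} (hσ : σ ∈ formSubmodule k U) {x₀ : X}
    {v : E} (hv : v ∈ chartDomain U x₀) : DifferentiableAt ℝ (chartRep x₀ σ) v :=
  ((hσ.1 x₀).contDiffAt ((isOpen_chartDomain U x₀).mem_nhds hv)).differentiableAt (by simp)

/-- The exterior derivative may be computed in any chart. -/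
lemma chartRep_extDerivField [IsManifold 𝓘(ℝ, E) ∞ X] {U : Opens X} {σ : FormField E X k}
    (hσ : σ ∈ formSubmodule k U) (x₀ : X) {v : E} (hv : v ∈ chartDomain U x₀) :
    chartRep x₀ (extDerivField σ) v = extDeriv (chartRep x₀ σ) v := by
  set e₀ := extChartAt 𝓘(ℝ, E) x₀ with he₀
  set x := e₀.symm v with hx
  set e := extChartAt 𝓘(ℝ, E) x with he
  have hxU : x ∈ U := hv.2
  set φ : E → E := e ∘ e₀.symm with hφ
  have hsmooth : ContDiffAt ℝ ∞ φ v := by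
    have h1 : ContMDiffAt 𝓘(ℝ, E) 𝓘(ℝ, E) ∞ e₀.symm v :=
      (contMDiffOn_extChartAt_symm x₀).contMDiffAt ((isOpen_extChartAt_target x₀).mem_nhds hv.1)
    have h2 : ContMDiffAt 𝓘(ℝ, E) 𝓘(ℝ, E) ∞ e (e₀.symm v) := contMDiffAt_extChartAt
    exact (h2.comp v h1).contDiffAt
  have hsmooth2 : ContDiffAt ℝ 2 φ v := hsmooth.of_le (by
     simpa using (WithTop.coe_le_coe.2 (le_top : (2 : ℕ∞) ≤ ⊤)))
  have hsymmdiff : ∀ (y : X) (w : E), w ∈ (extChartAt 𝓘(ℝ, E) y).target →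
      MDifferentiableAt 𝓘(ℝ, E) 𝓘(ℝ, E) (extChartAt 𝓘(ℝ, E) y).symm w := fun y w hw =>
    ((contMDiffOn_extChartAt_symm (n := ∞) y).contMDiffAt
      ((isOpen_extChartAt_target y).mem_nhds hw)).mdifferentiableAt (by simp)
  have hcont : ContinuousAt e₀.symm v := (hsymmdiff x₀ v hv.1).continuousAt
  have hev : ∀ᶠ w in 𝓝 v, w ∈ e₀.target ∧ e₀.symm w ∈ e.source :=
    Filter.Eventually.and ((isOpen_extChartAt_target x₀).mem_nhds hv.1)
      (hcont.eventually ((isOpen_extChartAt_source x).mem_nhds (mem_extChartAt_source x)))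
  have hev' := hev.eventually_nhds
  have hrep : chartRep x₀ σ =ᶠ[𝓝 v]
      fun w => (chartRep x σ (φ w)).compContinuousLinearMap (fderiv ℝ φ w) := by
    filter_upwards [hev', hsmooth2.eventually (by simp)] with w hw hsw
    have hw0 := hw.self_of_nhds
    have hpt : e.symm (φ w) = e₀.symm w := e.left_inv hw0.2
    have hgerm : e.symm ∘ φ =ᶠ[𝓝 w] e₀.symm := by
      filter_upwards [hw] with u hu
      exact e.left_inv hu.2
    have hφw : φ w ∈ e.target := e.map_source hw0.2
    have hder : (mfderiv 𝓘(ℝ, E) 𝓘(ℝ, E) e₀.symm w : E →L[ℝ] E) =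
        (mfderiv 𝓘(ℝ, E) 𝓘(ℝ, E) e.symm (φ w) : E →L[ℝ] E).comp (fderiv ℝ φ w) := by
      have hc := mfderiv_comp w (hsymmdiff x (φ w) hφw)
        (hsw.differentiableAt (by simp)).mdifferentiableAt
      rw [mfderiv_eq_fderiv] at hc
      have hg : (mfderiv 𝓘(ℝ, E) 𝓘(ℝ, E) (e.symm ∘ φ) w : E →L[ℝ] E) =
          mfderiv 𝓘(ℝ, E) 𝓘(ℝ, E) e₀.symm w := hgerm.mfderiv_eq
      exact hg.symm.trans hc
    have key : ∀ (p q : X) (A B D : E →L[ℝ] E), p = q → A = B.comp D →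
        ((σ q : E [⋀^Fin k]→L[ℝ] ℝ).compContinuousLinearMap A) =
        ((σ p : E [⋀^Fin k]→L[ℝ] ℝ).compContinuousLinearMap B).compContinuousLinearMap D := by
      rintro p q A B D rfl rfl
      rfl
    exact key _ _ _ _ _ hpt hder
  have hφv : φ v = e x := rfl
  have hd : DifferentiableAt ℝ (chartRep x σ) (φ v) := by
    rw [hφv]
    exact Form.differentiableAt hσ (mem_chartDomain_self hxU)
  rw [hrep.extDeriv_eq, extDeriv_pullback hd hsmooth2 (by simp)]
  have hder : fderiv ℝ φ v = (mfderiv 𝓘(ℝ, E) 𝓘(ℝ, E) e x : E →L[ℝ] E).comp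
      (mfderiv 𝓘(ℝ, E) 𝓘(ℝ, E) e₀.symm v : E →L[ℝ] E) := by
    rw [← mfderiv_eq_fderiv]
    exact mfderiv_comp v (mdifferentiableAt_extChartAt (mem_chart_source E x))
      (hsymmdiff x₀ v hv.1)
  rw [hder]
  rfl

open Classical in
/-- The exterior derivative `d : Ω^k(U) → Ω^(k+1)(U)`. -/
def d [IsManifold 𝓘(ℝ, E) ∞ X] (k : ℕ) (U : Opens X) : Form E k U →ₗ[ℝ] Form E (k + 1) U where
  toFun σ := Form.mk (fun x => if x ∈ U then extDerivField σ x else 0) <| by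
    refine ⟨fun x₀ => ?_, fun x hx => if_neg hx⟩
    have h1 : ContDiffOn ℝ ∞ (extDeriv (chartRep x₀ σ)) (chartDomain U x₀) :=
      (ContinuousAlternatingMap.alternatizeUncurryFinCLM ℝ E ℝ).contDiff.comp_contDiffOn
        ((σ.mem.1 x₀).fderiv_of_isOpen (isOpen_chartDomain U x₀) (by simp))
    refine h1.congr fun v hv => ?_
    rw [chartRep_congr (σ' := extDerivField σ) (fun x hx => if_pos hx) x₀ hv]
    exact chartRep_extDerivField σ.mem x₀ hv
  map_add' a b := by
    refine Form.ext fun x => ?_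
    change (if x ∈ U then extDerivField (a + b) x else 0) =
      (if x ∈ U then extDerivField a x else 0) + (if x ∈ U then extDerivField b x else 0)
    by_cases hx : x ∈ U
    · have h : extDerivField (a + b) x = extDerivField a x + extDerivField b x := by
        have := extDeriv_add (Form.differentiableAt a.mem (mem_chartDomain_self hx))
          (Form.differentiableAt b.mem (mem_chartDomain_self hx))
        have h' : chartRep x (a + b) = chartRep x a + chartRep x b := rfl
        unfold extDerivField
        rw [h', this]
        rfl
      simpa [hx] using h
    · simp [hx]
  map_smul' c a := by
    refine Form.ext fun x => ?_
    change (if x ∈ U then extDerivField (c • a) x else 0) =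
      c • (if x ∈ U then extDerivField a x else 0)
    by_cases hx : x ∈ U
    · have h : extDerivField (c • a) x = c • extDerivField a x := by
        have := extDeriv_smul c (chartRep x a) (x := extChartAt 𝓘(ℝ, E) x x)
        have h' : chartRep x (c • a) = c • chartRep x a := rfl
        unfold extDerivField
        rw [h', this]
        rfl
      simpa [hx] using h
    · simp [hx]

lemma d_apply [IsManifold 𝓘(ℝ, E) ∞ X] {U : Opens X} (σ : Form E k U) {x : X} (hx : x ∈ U) :
    d k U σ x = extDerivField σ x := if_pos hx

open Classical in
/-- Restriction of forms `Ω^k(U) → Ω^k(V)` for `V ⊆ U`. -/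
def restrict (k : ℕ) {U V : Opens X} (h : V ≤ U) : Form E k U →ₗ[ℝ] Form E k V where
  toFun σ := Form.mk (fun x => if x ∈ V then σ x else 0) <| by
    refine ⟨fun x₀ => ?_, fun x hx => if_neg hx⟩
    refine ((σ.mem.1 x₀).mono fun v hv => ⟨hv.1, h hv.2⟩).congr ?_
    exact chartRep_congr (fun x hx => if_pos hx) x₀
  map_add' a b := by
    refine Form.ext fun x => ?_
    change (if x ∈ V then (a + b) x else 0) = (if x ∈ V then a x else 0) + (if x ∈ V then b x else 0)
    by_cases hx : x ∈ V <;> simp [hx]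
  map_smul' c a := by
    refine Form.ext fun x => ?_
    change (if x ∈ V then (c • a) x else 0) = c • (if x ∈ V then a x else 0)
    by_cases hx : x ∈ V <;> simp [hx]

lemma restrict_apply {U V : Opens X} (h : V ≤ U) (σ : Form E k U) {x : X} (hx : x ∈ V) :
    restrict k h σ x = σ x := if_pos hx

end Forms

/-! ### De Rham cohomology of open subsets -/

section Cohomology

variable (E : Type*) [NormedAddCommGroup E] [NormedSpace ℝ E]
variable {X : Type*} [TopologicalSpace X] [ChartedSpace E X] [IsManifold 𝓘(ℝ, E) ∞ X]

/-- The closed `k`-forms on `U`. -/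
def closedForms (k : ℕ) (U : Opens X) : Submodule ℝ (Form E k U) :=
  LinearMap.ker (d k U)

/-- The exact `k`-forms on `U`. -/
def exactForms : (k : ℕ) → (U : Opens X) → Submodule ℝ (Form E k U)
  | 0, _ => ⊥
  | k + 1, U => LinearMap.range (d k U)

/-- The de Rham cohomology `H^k(U)`: closed forms modulo exact forms. -/
abbrev HdR (k : ℕ) (U : Opens X) :=
  closedForms E k U ⧸ (exactForms E k U).submoduleOf (closedForms E k U)

variable {E}

/-- The cohomology class of a closed form. -/
def HdR.mk {k : ℕ} {U : Opens X} (σ : closedForms E k U) : HdR E k U :=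
  Submodule.Quotient.mk σ

lemma d_restrict (k : ℕ) {U V : Opens X} (h : V ≤ U) (σ : Form E k U) :
    d k V (restrict k h σ) = restrict (k + 1) h (d k U σ) := by
  refine Form.ext fun x => ?_
  by_cases hx : x ∈ V
  · rw [d_apply _ hx, restrict_apply h _ hx, d_apply _ (h hx)]
    exact extDerivField_congr (fun x hx => restrict_apply h σ hx) hx
  · rw [(d k V _).mem.2 x hx, (restrict (k + 1) h _).mem.2 x hx]

/-- Restriction of closed forms. -/
def restrictClosed (k : ℕ) {U V : Opens X} (h : V ≤ U) :
    closedForms E k U →ₗ[ℝ] closedForms E k V :=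
  (restrict k h).restrict fun σ hσ => by
    have hσ' : d k U σ = 0 := hσ
    change d k V (restrict k h σ) = 0
    rw [d_restrict, hσ', map_zero]

lemma restrict_mem_exactForms (k : ℕ) {U V : Opens X} (h : V ≤ U) {σ : Form E k U}
    (hσ : σ ∈ exactForms E k U) : restrict k h σ ∈ exactForms E k V := by
  cases k with
  | zero =>
    have : σ = 0 := hσ
    rw [this, map_zero]
    exact Submodule.zero_mem _
  | succ k =>
    obtain ⟨α, rfl⟩ := hσ
    exact ⟨restrict k h α, d_restrict k h α⟩

/-- The restriction map `H^k(U) → H^k(V)` for `V ⊆ U`. -/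
def HdR.restrict (k : ℕ) {U V : Opens X} (h : V ≤ U) :
    HdR E k U →ₗ[ℝ] HdR E k V :=
  Submodule.mapQ _ _ (restrictClosed k h) fun _ hσ => restrict_mem_exactForms k h hσ

/-- A symplectic form on `X`: a smooth, closed, nondegenerate 2-form. -/
def IsSymplectic (σ : FormField E X 2) : Prop :=
  (∃ h : σ ∈ formSubmodule 2 (⊤ : Opens X), Form.mk σ h ∈ closedForms E 2 ⊤) ∧
    ∀ (x : X) (v : TangentSpace 𝓘(ℝ, E) x), (∀ w, σ x ![v, w] = 0) → v = 0

end Cohomology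

/-! ### Almost-complex structures and tameness -/

section Tame

variable {E : Type*} [NormedAddCommGroup E] [NormedSpace ℝ E]
variable {F : Type*} [NormedAddCommGroup F] [NormedSpace ℝ F]
variable {X : Type*} [TopologicalSpace X] [ChartedSpace E X]
variable {Y : Type*} [TopologicalSpace Y] [ChartedSpace F Y]

/-- A continuous almost-complex structure on `X`: a continuous bundle map `J : TX → TX` covering
the identity, linear on fibers, with `J ∘ J = -id`. -/
structure AlmostComplex (E : Type*) [NormedAddCommGroup E] [NormedSpace ℝ E]
    (X : Type*) [TopologicalSpace X] [ChartedSpace E X] [IsManifold 𝓘(ℝ, E) 1 X] where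
  /-- The complex structure on each tangent space. -/
  toFun : (x : X) → TangentSpace 𝓘(ℝ, E) x →L[ℝ] TangentSpace 𝓘(ℝ, E) x
  sq_eq_neg : ∀ (x : X) (v : TangentSpace 𝓘(ℝ, E) x), toFun x (toFun x v) = -v
  continuous_bundleMap : Continuous fun p : TangentBundle 𝓘(ℝ, E) X =>
    (⟨p.1, toFun p.1 p.2⟩ : TangentBundle 𝓘(ℝ, E) X)

/-- The pullback `f^* σ` of a field of `k`-forms. -/
def pullback {k : ℕ} (f : X → Y) (σ : FormField F Y k) : FormField E X k := fun x =>
  (σ (f x)).compContinuousLinearMap (mfderiv 𝓘(ℝ, E) 𝓘(ℝ, F) f x)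

variable [IsManifold 𝓘(ℝ, E) 1 X]

/-- `J` is `(σ, f)`-tame: `f^* σ (v, J v) > 0` for each tangent vector `v ∉ ker df`. -/
def AlmostComplex.IsTame (J : AlmostComplex E X) (σ : FormField F Y 2) (f : X → Y) : Prop :=
  ∀ (x : X) (v : TangentSpace 𝓘(ℝ, E) x), v ∉ (mfderiv 𝓘(ℝ, E) 𝓘(ℝ, F) f x).ker →
    0 < pullback f σ x ![v, J.toFun x v]

/-- The 2-form `η` on `T_x X` tames `J` on the subspace `S` of `T_x X`:
`η(v, J v) > 0` for each nonzero `v ∈ S`. -/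
def TamesOn (J : AlmostComplex E X) (x : X) (η : (TangentSpace 𝓘(ℝ, E) x) [⋀^Fin 2]→L[ℝ] ℝ)
    (S : Submodule ℝ (TangentSpace 𝓘(ℝ, E) x)) : Prop :=
  ∀ v ∈ S, v ≠ 0 → 0 < η ![v, J.toFun x v]

end Tame

end GeomForms

end

/-!
The argument is Gompf's gluing of fiberwise taming forms. Write `c = [ζ]`. On each `W y` the form
`η_y` differs from `ζ` by an exact form `dα_y`. On `WC` all the `η_y` agree, so two of the `α_y`
differ there by a closed form; by surjectivity of `H¹(W y) → H¹(WC)` this difference extends to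
`W y` up to an exact form `dg`, and cutting off `g` corrects the `α_y` so that they coincide on one
neighborhood of `C` (`exists_compatible_primitives`).

Since `X - int C` is compact, finitely many preimages `f⁻¹(U_i)` with `f⁻¹(U_i) ⊆ W y_i` cover `X`
(`exists_finset_cover_preimage_subset`). With a partition of unity `ρ_i` on `Y` subordinate to the
`U_i`, put `A = ∑ (ρ_i ∘ f) α_{y_i}` and `η = ζ + dA`. Then `[η] = c`, near `C` the form `η` is the
common restriction `η_C`, and on `ker df` the terms `d(ρ_i ∘ f) ∧ α_{y_i}` vanish, so that `η`
restricts to the convex combination `∑ (ρ_i ∘ f) η_{y_i}`, which tames `J` there; here `ker df` is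
`J`-invariant because `J` is `(ω_Y, f)`-tame (`exists_closedForm_taming_ker`).

Finally `f^*ω_Y(v, Jv) ≥ 0`, with equality only on `ker df`, where `η(v, Jv) > 0`. Compactness of
the unit sphere bundle over `X - int C` gives `t₀` with `tη + f^*ω_Y` taming there for `t < t₀`
(`eventually_tamesOn_of_isCompact`); on `C` every positive `t` works. The form `tη + f^*ω_Y` is
closed since pullback commutes with `d` (`d_pullback_eq_zero`), and a form that tames `J` is
nondegenerate.
-/

noncomputable section

namespace GeomForms

/-! ### Exterior derivative, and products with functions -/

section Products

variable {E : Type*} [NormedAddCommGroup E] [NormedSpace ℝ E]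
variable {X : Type*} [TopologicalSpace X] [ChartedSpace E X] [IsManifold 𝓘(ℝ, E) ∞ X] {k : ℕ}

lemma contDiffOn_comp_extChartAt_symm {ψ : X → ℝ} (hψ : ContMDiff 𝓘(ℝ, E) 𝓘(ℝ, ℝ) ∞ ψ) (x₀ : X) :
    ContDiffOn ℝ ∞ (ψ ∘ (extChartAt 𝓘(ℝ, E) x₀).symm) (extChartAt 𝓘(ℝ, E) x₀).target :=
  (hψ.comp_contMDiffOn (contMDiffOn_extChartAt_symm x₀)).contDiffOn

omit [IsManifold 𝓘(ℝ, E) ∞ X] in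
lemma chartRep_smul (ψ : X → ℝ) (σ : FormField E X k) (x₀ : X) (v : E) :
    chartRep x₀ (fun x => ψ x • σ x) v =
      (ψ ∘ (extChartAt 𝓘(ℝ, E) x₀).symm) v • chartRep x₀ σ v := rfl

/-- Extension by zero is smooth: outside `U` the product vanishes near every point, because `ψ` is
supported in `U`. -/
lemma smul_mem_formSubmodule {U : Opens X} {ψ : X → ℝ} (hψ : ContMDiff 𝓘(ℝ, E) 𝓘(ℝ, ℝ) ∞ ψ)
    (hU : tsupport ψ ⊆ U) {σ : FormField E X k} (hσ : σ ∈ formSubmodule k U) :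
    (fun x => ψ x • σ x) ∈ formSubmodule k (⊤ : Opens X) := by
  refine ⟨fun x₀ => fun v hv => ?_, fun x hx => absurd trivial hx⟩
  refine ContDiffAt.contDiffWithinAt ?_
  set e := extChartAt 𝓘(ℝ, E) x₀
  by_cases hvU : e.symm v ∈ U
  · have hv' : v ∈ chartDomain U x₀ := ⟨hv.1, hvU⟩
    exact ((contDiffOn_comp_extChartAt_symm hψ x₀).contDiffAt
      ((isOpen_extChartAt_target x₀).mem_nhds hv.1)).smul
      ((hσ.1 x₀).contDiffAt ((isOpen_chartDomain U x₀).mem_nhds hv'))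
  · have hc : ContinuousAt e.symm v :=
      (continuousOn_extChartAt_symm x₀).continuousAt ((isOpen_extChartAt_target x₀).mem_nhds hv.1)
    have h0 : ψ =ᶠ[𝓝 (e.symm v)] 0 := notMem_tsupport_iff_eventuallyEq.1 fun h => hvU (hU h)
    refine (contDiffAt_const (c := (0 : E [⋀^Fin k]→L[ℝ] ℝ))).congr_of_eventuallyEq ?_
    filter_upwards [hc.eventually h0] with w hw
    rw [chartRep_smul]
    simp only [Function.comp]
    rw [hw]
    exact zero_smul ℝ _

/-- The product of a form on `U` with a smooth function supported in `U`, as a form on `X`. -/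
def Form.smulExtend {U : Opens X} (ψ : X → ℝ) (hψ : ContMDiff 𝓘(ℝ, E) 𝓘(ℝ, ℝ) ∞ ψ)
    (hU : tsupport ψ ⊆ U) (σ : Form E k U) : Form E k (⊤ : Opens X) :=
  Form.mk (fun x => ψ x • σ x) (smul_mem_formSubmodule hψ hU σ.mem)

lemma Form.smulExtend_apply {U : Opens X} (ψ : X → ℝ) (hψ : ContMDiff 𝓘(ℝ, E) 𝓘(ℝ, ℝ) ∞ ψ)
    (hU : tsupport ψ ⊆ U) (σ : Form E k U) (x : X) :
    σ.smulExtend ψ hψ hU x = ψ x • σ x := rfl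

/-- The exterior derivative is local. -/
lemma d_congr {U V : Opens X} {σ : Form E k U} {τ : Form E k V} {x : X} (hxU : x ∈ U) (hxV : x ∈ V)
    (h : ∀ᶠ z in 𝓝 x, σ z = τ z) : d k U σ x = d k V τ x := by
  obtain ⟨N, hN, hNo, hxN⟩ := eventually_nhds_iff.1 h
  rw [d_apply _ hxU, d_apply _ hxV]
  exact extDerivField_congr (U := ⟨N, hNo⟩) hN hxN

theorem d_d {U : Opens X} (σ : Form E k U) : d (k + 1) U (d k U σ) = 0 := by
  refine Form.ext fun x => ?_
  by_cases hx : x ∈ U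
  · rw [d_apply _ hx]
    have h : chartRep x (d k U σ) =ᶠ[𝓝 (extChartAt 𝓘(ℝ, E) x x)] extDeriv (chartRep x σ) := by
      filter_upwards [(isOpen_chartDomain U x).mem_nhds (mem_chartDomain_self hx)] with v hv
      rw [chartRep_congr (fun z hz => d_apply σ hz) x hv]
      exact chartRep_extDerivField σ.mem x hv
    unfold extDerivField
    rw [h.extDeriv_eq, extDeriv_extDeriv_apply (r := ∞) ((σ.mem.1 x).contDiffAt
      ((isOpen_chartDomain U x).mem_nhds (mem_chartDomain_self hx)))
      (by simpa using (WithTop.coe_le_coe.2 (le_top : (2 : ℕ∞) ≤ ⊤)))]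
    rfl
  · exact (d _ U _).mem.2 x hx

lemma extDeriv_smul_apply_of_fderiv_eq_zero {g : E → ℝ} {τ : E → E [⋀^Fin k]→L[ℝ] ℝ} {p : E}
    (hg : DifferentiableAt ℝ g p) (hτ : DifferentiableAt ℝ τ p) {v : Fin (k + 1) → E}
    (hv : ∀ i, fderiv ℝ g p (v i) = 0) :
    extDeriv (fun q => g q • τ q) p v = g p • extDeriv τ p v := by
  unfold extDeriv
  rw [fderiv_fun_smul hg hτ]
  simp only [ContinuousAlternatingMap.alternatizeUncurryFin_apply]
  simp [hv, Finset.mul_sum, mul_left_comm]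

/-- On vectors in the kernel of `dψ` the term `dψ ∧ σ` of `d(ψσ)` vanishes, so `d(ψσ) = ψ dσ`. -/
theorem d_smulExtend_apply {U : Opens X} {ψ : X → ℝ} (hψ : ContMDiff 𝓘(ℝ, E) 𝓘(ℝ, ℝ) ∞ ψ)
    (hU : tsupport ψ ⊆ U) (σ : Form E k U) (x : X) (v : Fin (k + 1) → TangentSpace 𝓘(ℝ, E) x)
    (hv : ∀ i, mfderiv 𝓘(ℝ, E) 𝓘(ℝ, ℝ) ψ x (v i) = 0) :
    d k ⊤ (σ.smulExtend ψ hψ hU) x v = ψ x • d k U σ x v := by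
  by_cases hx : x ∈ U
  · rw [d_apply _ hx, d_apply _ (show x ∈ (⊤ : Opens X) from trivial)]
    set e := extChartAt 𝓘(ℝ, E) x with he
    have hg : MDifferentiableAt 𝓘(ℝ, E) 𝓘(ℝ, ℝ) ψ (e.symm (e x)) :=
      hψ.mdifferentiable (by simp) _
    have hs : MDifferentiableAt 𝓘(ℝ, E) 𝓘(ℝ, E) e.symm (e x) :=
      ((contMDiffOn_extChartAt_symm (n := ∞) x).contMDiffAt
        ((isOpen_extChartAt_target x).mem_nhds (mem_extChartAt_target x))).mdifferentiableAt
        (by simp)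
    have hse : (e.symm ∘ e) =ᶠ[𝓝 x] id := by
      filter_upwards [(isOpen_extChartAt_source (I := 𝓘(ℝ, E)) x).mem_nhds
        (mem_extChartAt_source x)] with z hz
      exact e.left_inv hz
    have hcomp : ψ =ᶠ[𝓝 x] (ψ ∘ e.symm) ∘ e := by
      filter_upwards [hse] with z hz
      exact congrArg ψ hz.symm
    have hd : MDifferentiableAt 𝓘(ℝ, E) 𝓘(ℝ, ℝ) (ψ ∘ e.symm) (e x) := hg.comp _ hs
    have hder : mfderiv 𝓘(ℝ, E) 𝓘(ℝ, ℝ) ψ x =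
        (fderiv ℝ (ψ ∘ e.symm) (e x)).comp (mfderiv 𝓘(ℝ, E) 𝓘(ℝ, E) e x) := by
      refine hcomp.mfderiv_eq.trans ?_
      rw [← mfderiv_eq_fderiv]
      exact mfderiv_comp x hd (mdifferentiableAt_extChartAt (mem_chart_source E x))
    have h1 := extDeriv_smul_apply_of_fderiv_eq_zero (g := ψ ∘ e.symm) (τ := chartRep x σ)
      (p := e x) hd.differentiableAt (Form.differentiableAt σ.mem (mem_chartDomain_self hx))
      (v := fun i => mfderiv 𝓘(ℝ, E) 𝓘(ℝ, E) e x (v i))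
      (fun i => by have := hv i; rw [hder] at this; exact this)
    have hpt : ψ x = (ψ ∘ e.symm) (e x) := hcomp.self_of_nhds
    rw [hpt]
    exact h1
  · have h0 : ψ =ᶠ[𝓝 x] 0 := notMem_tsupport_iff_eventuallyEq.1 fun h => hx (hU h)
    have h1 : d k ⊤ (σ.smulExtend ψ hψ hU) x = d k ⊤ (0 : Form E k (⊤ : Opens X)) x := by
      refine d_congr trivial trivial ?_
      filter_upwards [h0] with z hz
      rw [Form.smulExtend_apply, hz]
      exact zero_smul ℝ _
    rw [h1, map_zero, h0.self_of_nhds]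
    change (0 : ℝ) = (0 : ℝ) • _
    rw [zero_smul]

end Products

/-! ### Pullback of forms -/

section Pullback

variable {E : Type*} [NormedAddCommGroup E] [NormedSpace ℝ E]
variable {F : Type*} [NormedAddCommGroup F] [NormedSpace ℝ F]
variable {X : Type*} [TopologicalSpace X] [ChartedSpace E X] [IsManifold 𝓘(ℝ, E) ∞ X]
variable {Y : Type*} [TopologicalSpace Y] [ChartedSpace F Y] [IsManifold 𝓘(ℝ, F) ∞ Y] {k : ℕ}

/-- The pullback of a `k`-form along a linear map is smooth in both. Alternating maps are regarded
as multilinear maps, where pullback is a continuous multilinear operation; since `E` is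
finite-dimensional, the inclusion of the alternating maps has a continuous left inverse. -/
theorem contDiffAt_compContinuousLinearMap [FiniteDimensional ℝ E]
    {V : Type*} [NormedAddCommGroup V] [NormedSpace ℝ V]
    {n : WithTop ℕ∞} {τ : V → F [⋀^Fin k]→L[ℝ] ℝ} {A : V → E →L[ℝ] F} {p : V}
    (hτ : ContDiffAt ℝ n τ p) (hA : ContDiffAt ℝ n A p) :
    ContDiffAt ℝ n (fun q => (τ q).compContinuousLinearMap (A q)) p := by
  have hfin : Module.Finite ℝ (ContinuousMultilinearMap ℝ (fun _ : Fin k => E) ℝ) :=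
    Module.Finite.of_injective
      (ContinuousMultilinearMap.toMultilinearMapLinear :
        ContinuousMultilinearMap ℝ (fun _ : Fin k => E) ℝ →ₗ[ℝ]
          MultilinearMap ℝ (fun _ : Fin k => E) ℝ)
      ContinuousMultilinearMap.toMultilinearMap_injective
  obtain ⟨L, hL⟩ := LinearMap.exists_leftInverse_of_injective
    (ContinuousAlternatingMap.toContinuousMultilinearMapCLM ℝ :
      (E [⋀^Fin k]→L[ℝ] ℝ) →L[ℝ] _).toLinearMap
    (LinearMap.ker_eq_bot.2 ContinuousAlternatingMap.toContinuousMultilinearMap_injective)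
  have h1 : ContDiffAt ℝ n (fun q =>
      ContinuousMultilinearMap.compContinuousLinearMapContinuousMultilinear ℝ
        (fun _ : Fin k => E) (fun _ : Fin k => F) ℝ (fun _ => A q)) p :=
    (ContinuousMultilinearMap.contDiff _).contDiffAt.comp p (contDiffAt_pi.2 fun _ => hA)
  have h2 : ContDiffAt ℝ n (fun q =>
      ContinuousAlternatingMap.toContinuousMultilinearMapCLM ℝ (τ q)) p :=
    (ContinuousLinearMap.contDiff _).contDiffAt.comp p hτ
  have h3 := (LinearMap.toContinuousLinearMap L).contDiff.contDiffAt.comp p (h1.clm_apply h2)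
  convert h3 using 1
  funext q
  exact (LinearMap.congr_fun hL ((τ q).compContinuousLinearMap (A q))).symm

/-- In charts, the pullback of a field of forms by `f` is its pullback by the coordinate expression
of `f`. -/
lemma chartRep_pullback_eventuallyEq {f : X → Y} (hf : ContMDiff 𝓘(ℝ, E) 𝓘(ℝ, F) ∞ f)
    (σ : FormField F Y k) {x₀ : X} {v : E} (hv : v ∈ (extChartAt 𝓘(ℝ, E) x₀).target) {y₀ : Y}
    (hy : f ((extChartAt 𝓘(ℝ, E) x₀).symm v) ∈ (extChartAt 𝓘(ℝ, F) y₀).source) :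
    ContDiffAt ℝ ∞ (extChartAt 𝓘(ℝ, F) y₀ ∘ f ∘ (extChartAt 𝓘(ℝ, E) x₀).symm) v ∧
    chartRep x₀ (pullback (E := E) f σ) =ᶠ[𝓝 v] fun w =>
      (chartRep y₀ σ ((extChartAt 𝓘(ℝ, F) y₀ ∘ f ∘ (extChartAt 𝓘(ℝ, E) x₀).symm) w)
        ).compContinuousLinearMap
        (fderiv ℝ (extChartAt 𝓘(ℝ, F) y₀ ∘ f ∘ (extChartAt 𝓘(ℝ, E) x₀).symm) w) := by
  set e₀ := extChartAt 𝓘(ℝ, E) x₀ with he₀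
  set e := extChartAt 𝓘(ℝ, F) y₀ with he
  set φ : E → F := e ∘ f ∘ e₀.symm with hφ
  have hg : ∀ w ∈ e₀.target, ContMDiffAt 𝓘(ℝ, E) 𝓘(ℝ, F) ∞ (f ∘ e₀.symm) w := fun w hw =>
    (hf _).comp w ((contMDiffOn_extChartAt_symm x₀).contMDiffAt
      ((isOpen_extChartAt_target x₀).mem_nhds hw))
  have hsm : ∀ w ∈ e₀.target, f (e₀.symm w) ∈ e.source → ContDiffAt ℝ ∞ φ w := fun w hw hw' =>
    ((contMDiffAt_extChartAt' (by simpa [he] using hw')).comp w (hg w hw)).contDiffAt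
  refine ⟨hsm v hv hy, ?_⟩
  have hev : ∀ᶠ w in 𝓝 v, w ∈ e₀.target ∧ f (e₀.symm w) ∈ e.source :=
    Filter.Eventually.and ((isOpen_extChartAt_target x₀).mem_nhds hv)
      ((hg v hv).continuousAt.eventually ((isOpen_extChartAt_source y₀).mem_nhds hy))
  filter_upwards [hev.eventually_nhds] with w hw
  have hw0 := hw.self_of_nhds
  have hpt : e.symm (φ w) = f (e₀.symm w) := e.left_inv hw0.2
  have hgerm : e.symm ∘ φ =ᶠ[𝓝 w] f ∘ e₀.symm := by
    filter_upwards [hw] with u hu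
    exact e.left_inv hu.2
  have hφw : φ w ∈ e.target := e.map_source hw0.2
  have hsymm : MDifferentiableAt 𝓘(ℝ, F) 𝓘(ℝ, F) e.symm (φ w) :=
    ((contMDiffOn_extChartAt_symm (n := ∞) y₀).contMDiffAt
      ((isOpen_extChartAt_target y₀).mem_nhds hφw)).mdifferentiableAt (by simp)
  have hsymm₀ : MDifferentiableAt 𝓘(ℝ, E) 𝓘(ℝ, E) e₀.symm w :=
    ((contMDiffOn_extChartAt_symm (n := ∞) x₀).contMDiffAt
      ((isOpen_extChartAt_target x₀).mem_nhds hw0.1)).mdifferentiableAt (by simp)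
  have hder : (mfderiv 𝓘(ℝ, E) 𝓘(ℝ, F) f (e₀.symm w) : E →L[ℝ] F).comp
      (mfderiv 𝓘(ℝ, E) 𝓘(ℝ, E) e₀.symm w : E →L[ℝ] E) =
      (mfderiv 𝓘(ℝ, F) 𝓘(ℝ, F) e.symm (φ w) : F →L[ℝ] F).comp (fderiv ℝ φ w) := by
    have hc := mfderiv_comp w hsymm
      ((hsm w hw0.1 hw0.2).differentiableAt (by simp)).mdifferentiableAt
    rw [mfderiv_eq_fderiv] at hc
    have hc' := mfderiv_comp w (hf.mdifferentiable (by simp) (e₀.symm w)) hsymm₀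
    have hg : (mfderiv 𝓘(ℝ, E) 𝓘(ℝ, F) (e.symm ∘ φ) w : E →L[ℝ] F) =
        mfderiv 𝓘(ℝ, E) 𝓘(ℝ, F) (f ∘ e₀.symm) w := hgerm.mfderiv_eq
    exact hc'.symm.trans (hg.symm.trans hc)
  -- The base points are generalized so that the equality `hpt` of points of `Y` can be substituted
  -- in the dependent type of `σ`.
  have key : ∀ (p q : Y) (A : E →L[ℝ] F) (G : E →L[ℝ] E) (B : F →L[ℝ] F) (D : E →L[ℝ] F),
      p = q → A.comp G = B.comp D →
      ((σ q : F [⋀^Fin k]→L[ℝ] ℝ).compContinuousLinearMap A).compContinuousLinearMap G =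
      ((σ p : F [⋀^Fin k]→L[ℝ] ℝ).compContinuousLinearMap B).compContinuousLinearMap D := by
    rintro p q A G B D rfl h
    change (σ p : F [⋀^Fin k]→L[ℝ] ℝ).compContinuousLinearMap (A.comp G) =
      (σ p : F [⋀^Fin k]→L[ℝ] ℝ).compContinuousLinearMap (B.comp D)
    rw [h]
  exact key _ _ _ _ _ _ hpt hder

lemma pullback_mem_formSubmodule [FiniteDimensional ℝ E] {f : X → Y} (hf : ContMDiff 𝓘(ℝ, E) 𝓘(ℝ, F) ∞ f)
    {σ : FormField F Y k} (hσ : σ ∈ formSubmodule k (⊤ : Opens Y)) :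
    pullback (E := E) f σ ∈ formSubmodule k (⊤ : Opens X) := by
  refine ⟨fun x₀ v hv => ContDiffAt.contDiffWithinAt ?_, fun x hx => absurd trivial hx⟩
  set y₀ := f ((extChartAt 𝓘(ℝ, E) x₀).symm v) with hy₀
  obtain ⟨hφ, hrep⟩ := chartRep_pullback_eventuallyEq hf σ hv.1 (mem_extChartAt_source y₀)
  refine ContDiffAt.congr_of_eventuallyEq ?_ hrep
  refine contDiffAt_compContinuousLinearMap (ContDiffAt.comp (g := chartRep y₀ σ) v ?_ hφ)
    (hφ.fderiv_right (by simp))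
  exact (hσ.1 y₀).contDiffAt ((isOpen_chartDomain ⊤ y₀).mem_nhds
    (mem_chartDomain_self (U := (⊤ : Opens Y)) trivial))

theorem d_pullback_eq_zero [FiniteDimensional ℝ E] {f : X → Y} (hf : ContMDiff 𝓘(ℝ, E) 𝓘(ℝ, F) ∞ f)
    {σ : FormField F Y k} (hσ : σ ∈ formSubmodule k (⊤ : Opens Y))
    (hd : d k ⊤ (Form.mk σ hσ) = 0) :
    d k ⊤ (Form.mk (pullback (E := E) f σ) (pullback_mem_formSubmodule hf hσ)) = 0 := by
  refine Form.ext fun x => ?_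
  rw [d_apply _ (show x ∈ (⊤ : Opens X) from trivial)]
  set v := extChartAt 𝓘(ℝ, E) x x with hv
  have hx : (extChartAt 𝓘(ℝ, E) x).symm v = x := extChartAt_to_inv x
  set y₀ := f ((extChartAt 𝓘(ℝ, E) x).symm v) with hy₀
  obtain ⟨hφ, hrep⟩ := chartRep_pullback_eventuallyEq hf σ (mem_extChartAt_target x)
    (mem_extChartAt_source y₀)
  have hmem : extChartAt 𝓘(ℝ, F) y₀ y₀ ∈ chartDomain (⊤ : Opens Y) y₀ :=
    mem_chartDomain_self (U := (⊤ : Opens Y)) trivial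
  have h0 : extDeriv (chartRep y₀ σ) (extChartAt 𝓘(ℝ, F) y₀ y₀) = 0 := by
    have h := chartRep_congr (U := (⊤ : Opens Y)) (fun z hz => d_apply (Form.mk σ hσ) hz) y₀ hmem
    rw [hd] at h
    exact (chartRep_extDerivField hσ y₀ hmem).symm.trans h.symm
  have h1 := (hrep.extDeriv_eq).trans (extDeriv_pullback (Form.differentiableAt hσ hmem) hφ
    (by simpa using (WithTop.coe_le_coe.2 (le_top : (2 : ℕ∞) ≤ ⊤))))
  change (extDeriv (chartRep x (pullback (E := E) f σ)) v).compContinuousLinearMap _ = 0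
  rw [h1]
  have h2 : extDeriv (chartRep y₀ σ)
    ((extChartAt 𝓘(ℝ, F) y₀ ∘ f ∘ (extChartAt 𝓘(ℝ, E) x).symm) v) = 0 := h0
  rw [h2]
  rfl

end Pullback

/-! ### Tameness near compact sets -/

section Tameness

variable {E : Type*} [NormedAddCommGroup E] [NormedSpace ℝ E]
variable {F : Type*} [NormedAddCommGroup F] [NormedSpace ℝ F]
variable {X : Type*} [TopologicalSpace X] [ChartedSpace E X] [IsManifold 𝓘(ℝ, E) ∞ X]
variable {Y : Type*} [TopologicalSpace Y] [ChartedSpace F Y]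

/-- The value of a 2-form in terms of the trivialization of the tangent bundle at `x₀`. -/
lemma apply_eq_chartRep (σ : FormField E X 2) {x₀ x : X} (hx : x ∈ (chartAt E x₀).source)
    (u w : TangentSpace 𝓘(ℝ, E) x) :
    σ x ![u, w] = chartRep x₀ σ (extChartAt 𝓘(ℝ, E) x₀ x)
      ![(trivializationAt E (TangentSpace 𝓘(ℝ, E)) x₀ ⟨x, u⟩).2,
        (trivializationAt E (TangentSpace 𝓘(ℝ, E)) x₀ ⟨x, w⟩).2] := by
  set e := extChartAt 𝓘(ℝ, E) x₀ with he
  have hxe : x ∈ e.source := by simpa [he] using hx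
  have hb : x ∈ (trivializationAt E (TangentSpace 𝓘(ℝ, E)) x₀).baseSet := by simpa using hx
  have hT : ∀ z : TangentSpace 𝓘(ℝ, E) x,
      (trivializationAt E (TangentSpace 𝓘(ℝ, E)) x₀ ⟨x, z⟩).2 =
        mfderiv 𝓘(ℝ, E) 𝓘(ℝ, E) e x z := fun z =>
    (congrFun (Bundle.Trivialization.coe_linearMapAt_of_mem (R := ℝ) _ hb) z).symm.trans
      (DFunLike.congr_fun (TangentBundle.continuousLinearMapAt_trivializationAt hx) z)
  have hinv : ∀ z : TangentSpace 𝓘(ℝ, E) x, mfderiv 𝓘(ℝ, E) 𝓘(ℝ, E) e.symm (e x)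
      (mfderiv 𝓘(ℝ, E) 𝓘(ℝ, E) e x z) = z := fun z => by
    have h := mfderivWithin_extChartAt_symm_comp_mfderiv_extChartAt' (I := 𝓘(ℝ, E)) hxe
    simp only [modelWithCornersSelf_coe, range_id, mfderivWithin_univ] at h
    exact DFunLike.congr_fun h z
  -- Generalizing the base point allows substitution of `e.symm (e x) = x` in the type of `σ`.
  have key : ∀ (p : X) (A : E →L[ℝ] E) (a b : E), p = x → A a = u → A b = w →
      (σ x : E [⋀^Fin 2]→L[ℝ] ℝ) ![u, w] =
        (σ p : E [⋀^Fin 2]→L[ℝ] ℝ).compContinuousLinearMap A ![a, b] := by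
    rintro p A a b rfl ha hb
    change (σ p : E [⋀^Fin 2]→L[ℝ] ℝ) _ = (σ p : E [⋀^Fin 2]→L[ℝ] ℝ) fun i => A (![a, b] i)
    congr 1
    funext i
    fin_cases i
    · exact ha.symm
    · exact hb.symm
  rw [hT, hT]
  exact key _ _ _ _ (e.left_inv hxe) (hinv u) (hinv w)

theorem continuous_apply_almostComplex (J : AlmostComplex E X) {σ : FormField E X 2}
    (hσ : σ ∈ formSubmodule 2 (⊤ : Opens X)) :
    Continuous fun p : TangentBundle 𝓘(ℝ, E) X => σ p.1 ![p.2, J.toFun p.1 p.2] := by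
  refine continuous_iff_continuousAt.2 fun p₀ => ?_
  set x₀ := p₀.1 with hx₀
  set T := trivializationAt E (TangentSpace 𝓘(ℝ, E)) x₀ with hT
  have hproj : Continuous fun p : TangentBundle 𝓘(ℝ, E) X => p.1 :=
    FiberBundle.continuous_proj E (TangentSpace 𝓘(ℝ, E))
  have hev : (fun p : TangentBundle 𝓘(ℝ, E) X => σ p.1 ![p.2, J.toFun p.1 p.2]) =ᶠ[𝓝 p₀]
      fun p => chartRep x₀ σ (extChartAt 𝓘(ℝ, E) x₀ p.1)
        ![(T p).2, (T ⟨p.1, J.toFun p.1 p.2⟩).2] := by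
    filter_upwards [hproj.continuousAt.eventually (chart_source_mem_nhds E x₀)] with p hp
    exact apply_eq_chartRep σ hp _ _
  refine ContinuousAt.congr ?_ hev.symm
  have hTc : ∀ q : TangentBundle 𝓘(ℝ, E) X, q.1 = x₀ → ContinuousAt (fun p => (T p).2) q :=
    fun q hq => continuous_snd.continuousAt.comp (T.continuousAt
      (by rw [T.mem_source]; rw [show Bundle.TotalSpace.proj q = x₀ from hq]
          exact mem_baseSet_trivializationAt E _ x₀))
  have h1 := hTc p₀ rfl
  have h2 : ContinuousAt (fun p : TangentBundle 𝓘(ℝ, E) X => (T ⟨p.1, J.toFun p.1 p.2⟩).2) p₀ :=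
    ContinuousAt.comp (f := fun p : TangentBundle 𝓘(ℝ, E) X =>
      (⟨p.1, J.toFun p.1 p.2⟩ : TangentBundle 𝓘(ℝ, E) X)) (hTc ⟨x₀, J.toFun x₀ p₀.2⟩ rfl)
      J.continuous_bundleMap.continuousAt
  have h3 : ContinuousAt (fun p : TangentBundle 𝓘(ℝ, E) X =>
      chartRep x₀ σ (extChartAt 𝓘(ℝ, E) x₀ p.1)) p₀ := by
    refine ContinuousAt.comp (g := chartRep x₀ σ) (f := fun p : TangentBundle 𝓘(ℝ, E) X =>
      extChartAt 𝓘(ℝ, E) x₀ p.1) ?_ ?_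
    · exact (Form.differentiableAt hσ (mem_chartDomain_self (U := ⊤) trivial)).continuousAt
    · exact ContinuousAt.comp (f := fun p : TangentBundle 𝓘(ℝ, E) X => p.1)
        (continuousAt_extChartAt (I := 𝓘(ℝ, E)) x₀) hproj.continuousAt
  have h4 : ContinuousAt (fun p : TangentBundle 𝓘(ℝ, E) X =>
      (![(T p).2, (T ⟨p.1, J.toFun p.1 p.2⟩).2] : Fin 2 → E)) p₀ := by
    refine continuousAt_pi.2 fun i => ?_
    fin_cases i
    · exact h1
    · exact h2
  exact h3.eval h4

/-- Taming by `tη + σ` for small `t > 0`, uniformly near `x₀`. In the trivialization at `x₀` it is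
enough, by homogeneity, to treat the unit sphere, which is compact. Near a unit vector with
`σ(v, Jv) > 0` small `t` work, and near one with `η(v, Jv) > 0` every `t > 0` works. -/
theorem eventually_tamesOn_nhds [FiniteDimensional ℝ E] (J : AlmostComplex E X)
    {η σ : FormField E X 2}
    (hη : η ∈ formSubmodule 2 (⊤ : Opens X)) (hσ : σ ∈ formSubmodule 2 (⊤ : Opens X))
    (hnn : ∀ (x : X) (v : TangentSpace 𝓘(ℝ, E) x), 0 ≤ σ x ![v, J.toFun x v]) (x₀ : X)
    (hpos : ∀ v : TangentSpace 𝓘(ℝ, E) x₀, v ≠ 0 → σ x₀ ![v, J.toFun x₀ v] = 0 →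
      0 < η x₀ ![v, J.toFun x₀ v]) :
    ∀ᶠ z : ℝ × X in 𝓝[>] 0 ×ˢ 𝓝 x₀, TamesOn J z.2 (z.1 • η z.2 + σ z.2) ⊤ := by
  set T := trivializationAt E (TangentSpace 𝓘(ℝ, E)) x₀ with hT
  have hx₀ : x₀ ∈ T.baseSet := mem_baseSet_trivializationAt E _ x₀
  have ha := continuous_apply_almostComplex J hη
  have hb := continuous_apply_almostComplex J hσ
  set a : TangentBundle 𝓘(ℝ, E) X → ℝ := fun p => η p.1 ![p.2, J.toFun p.1 p.2] with ha'
  set b : TangentBundle 𝓘(ℝ, E) X → ℝ := fun p => σ p.1 ![p.2, J.toFun p.1 p.2] with hb'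
  have hloc : ∀ p : TangentBundle 𝓘(ℝ, E) X, 0 < a p ∨ 0 < b p →
      ∀ᶠ z : ℝ × TangentBundle 𝓘(ℝ, E) X in 𝓝[>] 0 ×ˢ 𝓝 p, 0 < z.1 * a z.2 + b z.2 := by
    rintro p (h | h)
    · have h1 : ∀ᶠ t : ℝ in 𝓝[>] 0, 0 < t := self_mem_nhdsWithin
      filter_upwards [h1.prod_mk (ha.continuousAt.eventually (lt_mem_nhds h))] with z hz
      exact add_pos_of_pos_of_nonneg (mul_pos hz.1 hz.2) (hnn _ _)
    · have hc : Continuous fun z : ℝ × TangentBundle 𝓘(ℝ, E) X => z.1 * a z.2 + b z.2 := by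
        fun_prop
      have h0 : 0 < (fun z : ℝ × TangentBundle 𝓘(ℝ, E) X => z.1 * a z.2 + b z.2) (0, p) := by
        simpa using h
      have := hc.continuousAt.eventually (lt_mem_nhds h0)
      rw [nhds_prod_eq] at this
      exact this.filter_mono (Filter.prod_mono nhdsWithin_le_nhds le_rfl)
  have hsphere : ∀ u ∈ Metric.sphere (0 : E) 1, ∀ᶠ z : (ℝ × X) × E in
      (𝓝[>] 0 ×ˢ 𝓝 x₀) ×ˢ 𝓝 u, 0 < z.1.1 * a (T.toOpenPartialHomeomorph.symm (z.1.2, z.2)) +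
        b (T.toOpenPartialHomeomorph.symm (z.1.2, z.2)) := by
    intro u hu
    have hu0 : u ≠ 0 := by
      rintro rfl
      simp at hu
    have hmem : (x₀, u) ∈ T.target := T.mem_target.2 hx₀
    have hc : Tendsto T.toOpenPartialHomeomorph.symm (𝓝 x₀ ×ˢ 𝓝 u)
        (𝓝 (T.toOpenPartialHomeomorph.symm (x₀, u))) := by
      rw [← nhds_prod_eq]
      exact T.toOpenPartialHomeomorph.continuousAt_symm hmem
    have hp : T.toOpenPartialHomeomorph.symm (x₀, u) = ⟨x₀, T.symm x₀ u⟩ :=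
      (T.mk_symm hx₀ u).symm
    have hne : T.symm x₀ u ≠ 0 := by
      intro h
      rw [← T.symmL_apply (R := ℝ) hx₀] at h
      have h2 := T.continuousLinearMapAt_symmL (R := ℝ) hx₀ u
      rw [h, map_zero] at h2
      exact hu0 h2.symm
    have hor : 0 < a (T.toOpenPartialHomeomorph.symm (x₀, u)) ∨
        0 < b (T.toOpenPartialHomeomorph.symm (x₀, u)) := by
      rw [hp]
      by_cases h : σ x₀ ![T.symm x₀ u, J.toFun x₀ (T.symm x₀ u)] = 0
      · exact Or.inl (hpos _ hne h)
      · exact Or.inr (lt_of_le_of_ne (hnn _ _) (Ne.symm h))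
    have hq : Tendsto (fun z : (ℝ × X) × E =>
        (z.1.1, T.toOpenPartialHomeomorph.symm (z.1.2, z.2))) ((𝓝[>] 0 ×ˢ 𝓝 x₀) ×ˢ 𝓝 u)
        (𝓝[>] 0 ×ˢ 𝓝 (T.toOpenPartialHomeomorph.symm (x₀, u))) :=
      (tendsto_fst.comp tendsto_fst).prodMk
        (hc.comp ((tendsto_snd.comp tendsto_fst).prodMk tendsto_snd))
    exact hq.eventually (hloc _ hor)
  have hall : ∀ᶠ z : (ℝ × X) × E in (𝓝[>] 0 ×ˢ 𝓝 x₀) ×ˢ 𝓝ˢ (Metric.sphere (0 : E) 1),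
      0 < z.1.1 * a (T.toOpenPartialHomeomorph.symm (z.1.2, z.2)) +
        b (T.toOpenPartialHomeomorph.symm (z.1.2, z.2)) :=
    (isCompact_sphere (0 : E) 1).mem_prod_nhdsSet_of_forall hsphere
  have hbase : ∀ᶠ z : ℝ × X in 𝓝[>] 0 ×ˢ 𝓝 x₀, z.2 ∈ T.baseSet :=
    tendsto_snd.eventually (T.open_baseSet.mem_nhds hx₀)
  filter_upwards [hall.curry, hbase] with z hz hzb
  intro v _ hv
  set w := T.continuousLinearMapAt ℝ z.2 v with hw
  have hvw : T.symmL ℝ z.2 w = v := T.symmL_continuousLinearMapAt hzb v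
  have hw0 : w ≠ 0 := fun h => hv (by rw [← hvw, h, map_zero])
  set r := ‖w‖ with hr
  have hr0 : 0 < r := norm_pos_iff.2 hw0
  have hmem : r⁻¹ • w ∈ Metric.sphere (0 : E) 1 := by
    simp [norm_smul, hr, hw0]
  have hz1 := hz.self_of_nhdsSet _ hmem
  have hp : T.toOpenPartialHomeomorph.symm (z.2, r⁻¹ • w) =
      (⟨z.2, r⁻¹ • v⟩ : TangentBundle 𝓘(ℝ, E) X) := by
    rw [← T.mk_symm hzb, ← T.symmL_apply (R := ℝ) hzb, map_smul, hvw]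
  have hsc : ∀ τ : FormField E X 2, τ z.2 ![r⁻¹ • v, J.toFun z.2 (r⁻¹ • v)] =
      (r ^ 2)⁻¹ * τ z.2 ![v, J.toFun z.2 v] := by
    intro τ
    have h : (![r⁻¹ • v, J.toFun z.2 (r⁻¹ • v)] : Fin 2 → TangentSpace 𝓘(ℝ, E) z.2) =
        fun i => r⁻¹ • ![v, J.toFun z.2 v] i := by
      ext i
      fin_cases i <;> simp
    rw [h]
    have := (τ z.2).toMultilinearMap.map_smul_univ (fun _ => r⁻¹) ![v, J.toFun z.2 v]
    simpa using this
  rw [hp] at hz1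
  simp only [ha', hb', hsc] at hz1
  have h5 : 0 < (r ^ 2)⁻¹ * (z.1 * η z.2 ![v, J.toFun z.2 v] + σ z.2 ![v, J.toFun z.2 v]) := by
    linarith
  exact (mul_pos_iff_of_pos_left (by positivity)).1 h5

theorem eventually_tamesOn_of_isCompact [FiniteDimensional ℝ E] (J : AlmostComplex E X)
    {η σ : FormField E X 2}
    (hη : η ∈ formSubmodule 2 (⊤ : Opens X)) (hσ : σ ∈ formSubmodule 2 (⊤ : Opens X))
    (hnn : ∀ (x : X) (v : TangentSpace 𝓘(ℝ, E) x), 0 ≤ σ x ![v, J.toFun x v])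
    {K : Set X} (hK : IsCompact K)
    (hpos : ∀ x ∈ K, ∀ v : TangentSpace 𝓘(ℝ, E) x, v ≠ 0 → σ x ![v, J.toFun x v] = 0 →
      0 < η x ![v, J.toFun x v]) :
    ∀ᶠ t : ℝ in 𝓝[>] 0, ∀ x ∈ K, TamesOn J x (t • η x + σ x) ⊤ := by
  have h := hK.mem_prod_nhdsSet_of_forall fun x hx =>
    eventually_tamesOn_nhds J hη hσ hnn x (hpos x hx)
  filter_upwards [Eventually.curry h] with t ht
  exact ht.self_of_nhdsSet

/-- A form that tames `J` on the whole tangent space is nondegenerate. -/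
lemma TamesOn.eq_zero_of_forall {J : AlmostComplex E X} {x : X}
    {σ : (TangentSpace 𝓘(ℝ, E) x) [⋀^Fin 2]→L[ℝ] ℝ} (h : TamesOn J x σ ⊤)
    {v : TangentSpace 𝓘(ℝ, E) x} (hv : ∀ w, σ ![v, w] = 0) : v = 0 := by
  by_contra hne
  exact (h v trivial hne).ne' (hv _)

omit [IsManifold 𝓘(ℝ, E) ∞ X] in
lemma pullback_apply_eq_zero {f : X → Y} (σ : FormField F Y 2) {x : X}
    {v : TangentSpace 𝓘(ℝ, E) x} (hv : v ∈ (mfderiv 𝓘(ℝ, E) 𝓘(ℝ, F) f x).ker)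
    (w : TangentSpace 𝓘(ℝ, E) x) : pullback (E := E) f σ x ![v, w] = 0 := by
  change σ (f x) (fun i => mfderiv 𝓘(ℝ, E) 𝓘(ℝ, F) f x (![v, w] i)) = 0
  exact (σ (f x)).toAlternatingMap.map_coord_zero 0 hv

lemma AlmostComplex.IsTame.nonneg {J : AlmostComplex E X} {σ : FormField F Y 2} {f : X → Y}
    (hJ : J.IsTame σ f) (x : X) (v : TangentSpace 𝓘(ℝ, E) x) :
    0 ≤ pullback (E := E) f σ x ![v, J.toFun x v] := by
  by_cases hv : v ∈ (mfderiv 𝓘(ℝ, E) 𝓘(ℝ, F) f x).ker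
  · exact (pullback_apply_eq_zero σ hv _).ge
  · exact (hJ x v hv).le

/-- `ker df` is `J`-invariant: for `v ∈ ker df` with `Jv ∉ ker df`, tameness would give
`f^*σ(Jv, J Jv) > 0`, but `J Jv = -v` lies in `ker df`. -/
lemma AlmostComplex.IsTame.map_mem_ker {J : AlmostComplex E X} {σ : FormField F Y 2} {f : X → Y}
    (hJ : J.IsTame σ f) {x : X} {v : TangentSpace 𝓘(ℝ, E) x}
    (hv : v ∈ (mfderiv 𝓘(ℝ, E) 𝓘(ℝ, F) f x).ker) :
    J.toFun x v ∈ (mfderiv 𝓘(ℝ, E) 𝓘(ℝ, F) f x).ker := by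
  by_contra h
  refine (hJ x _ h).ne' ?_
  rw [J.sq_eq_neg]
  change σ (f x) (fun i => mfderiv 𝓘(ℝ, E) 𝓘(ℝ, F) f x (![J.toFun x v, -v] i)) = 0
  refine (σ (f x)).toAlternatingMap.map_coord_zero 1 ?_
  have hv' : mfderiv 𝓘(ℝ, E) 𝓘(ℝ, F) f x v = 0 := hv
  change mfderiv 𝓘(ℝ, E) 𝓘(ℝ, F) f x (-v) = 0
  rw [map_neg, hv', neg_zero]

end Tameness

/-! ### Gluing primitives -/

section Gluing

variable {E : Type*} [NormedAddCommGroup E] [NormedSpace ℝ E]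
variable {X : Type*} [TopologicalSpace X] [ChartedSpace E X]

lemma Form.sum_apply {k : ℕ} {U : Opens X} {ι : Type*} (s : Finset ι) (a : ι → Form E k U) (x : X) :
    (∑ i ∈ s, a i : Form E k U) x = ∑ i ∈ s, a i x :=
  map_sum ({ toFun := fun σ => σ.toField x, map_zero' := rfl, map_add' := fun _ _ => rfl } :
    Form E k U →+ _) a s

variable [IsManifold 𝓘(ℝ, E) ∞ X]

lemma exists_primitive_of_mk_eq {k : ℕ} {U : Opens X} {a b : closedForms E (k + 1) U}
    (h : HdR.mk a = HdR.mk b) : ∃ α : Form E k U, d k U α = a.1 - b.1 :=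
  (Submodule.Quotient.eq _).1 h

/-- Closed 2-forms `η i` on `W i` in the class of `ζ` that agree on `V` have primitives `α i` of
`η i - ζ` that agree on a neighborhood of `C`, the same neighborhood for all `i`. -/
theorem exists_compatible_primitives [FiniteDimensional ℝ E] [T2Space X]
    [SecondCountableTopology X] {C : Set X} (hC : IsClosed C) {V : Opens X} (hCV : C ⊆ V)
    {ι : Type*} [Nonempty ι] {W : ι → Opens X} (hVW : ∀ i, V ≤ W i)
    (hH1 : ∀ i, Function.Surjective (HdR.restrict (E := E) 1 (hVW i)))
    {η : (i : ι) → closedForms E 2 (W i)} {ζ : closedForms E 2 (⊤ : Opens X)}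
    (hclass : ∀ i, HdR.mk (η i) = HdR.mk (restrictClosed 2 (le_top : W i ≤ ⊤) ζ))
    {ηV : closedForms E 2 V} (hagree : ∀ i, restrictClosed 2 (hVW i) (η i) = ηV) :
    ∃ (α : (i : ι) → Form E 1 (W i)) (N : Opens X), C ⊆ N ∧ N ≤ V ∧
      (∀ i, d 1 (W i) (α i) = (η i).1 - restrict 2 le_top ζ.1) ∧
      ∀ i j, ∀ x ∈ N, α i x = α j x := by
  have : LocallyCompactSpace X := ChartedSpace.locallyCompactSpace E X
  obtain ⟨φ, hφ0, hφ1, -⟩ := exists_contMDiffMap_zero_one_nhds_of_isClosed (n := ⊤) 𝓘(ℝ, E)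
    V.isOpen.isClosed_compl hC (disjoint_left.2 fun x hx hxC => hx (hCV hxC))
  have hsupp : tsupport φ ⊆ V := by
    intro x hx
    by_contra hxV
    exact notMem_tsupport_iff_eventuallyEq.2 (hφ0.filter_mono (nhds_le_nhdsSet hxV)) hx
  set N : Opens X := ⟨interior {x | φ x = 1}, isOpen_interior⟩ with hN
  have hNφ : ∀ x ∈ N, φ x = 1 := fun x hx =>
    interior_subset (s := {x | φ x = 1}) hx
  have hNV : N ≤ V := fun x hx => hsupp (subset_tsupport _ (by
    rw [Function.mem_support, hNφ x hx]
    exact one_ne_zero))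
  choose α hα using fun i => exists_primitive_of_mk_eq (hclass i)
  obtain ⟨o⟩ := ‹Nonempty ι›
  have hdα : ∀ i, d 1 V (restrict 1 (hVW i) (α i)) =
      ηV.1 - restrict 2 (hVW i) (restrict 2 le_top ζ.1) := fun i => by
    rw [d_restrict, hα, map_sub, ← hagree i]
    rfl
  have hζ : ∀ i, restrict 2 (hVW i) (restrict 2 (le_top : W i ≤ ⊤) ζ.1) =
      restrict 2 (le_top : V ≤ ⊤) ζ.1 := fun i => Form.ext fun x => by
    by_cases hx : x ∈ V
    · rw [restrict_apply _ _ hx, restrict_apply _ _ hx, restrict_apply _ _ (hVW i hx)]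
    · rw [(restrict 2 (hVW i) _).mem.2 x hx, (restrict 2 (le_top : V ≤ ⊤) _).mem.2 x hx]
  have hclosed : ∀ i, restrict 1 (hVW i) (α i) - restrict 1 (hVW o) (α o) ∈ closedForms E 1 V :=
    fun i => by
      change d 1 V _ = 0
      rw [map_sub, hdα, hdα, hζ, hζ, sub_self]
  have hβ : ∀ i, ∃ (β : closedForms E 1 (W i)) (g : Form E 0 V),
      d 0 V g = (restrict 1 (hVW i) (α i) - restrict 1 (hVW o) (α o)) -
        restrict 1 (hVW i) β.1 := fun i => by
    obtain ⟨b, hb⟩ := hH1 i (HdR.mk ⟨_, hclosed i⟩)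
    obtain ⟨β, rfl⟩ := Submodule.Quotient.mk_surjective _ b
    obtain ⟨g, hg⟩ := exists_primitive_of_mk_eq (a := ⟨_, hclosed i⟩)
      (b := restrictClosed 1 (hVW i) β) hb.symm
    exact ⟨β, g, hg⟩
  -- On `V`, the form `α i - α o - β i` is `d (g i)`; the corrected primitive
  -- `α i - β i - d (φ g i)` therefore equals `α o` on the interior `N` of `{φ = 1}`.
  choose β g hg using hβ
  refine ⟨fun i => α i - (β i).1 -
    d 0 (W i) (restrict 0 le_top ((g i).smulExtend φ φ.contMDiff hsupp)), N, ?_, hNV, fun i => ?_, ?_⟩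
  · exact subset_interior_iff_mem_nhdsSet.2 hφ1
  · have hβ0 : d 1 (W i) (β i).1 = 0 := (β i).2
    rw [map_sub, map_sub, d_d, hβ0, sub_zero, sub_zero, hα]
    rfl
  · have key : ∀ i, ∀ x ∈ N, (α i - (β i).1 -
        d 0 (W i) (restrict 0 le_top ((g i).smulExtend φ φ.contMDiff hsupp)) : Form E 1 (W i)) x =
          α o x := by
      intro i x hx
      have hxV := hNV hx
      have h1 : d 0 (W i) (restrict 0 le_top ((g i).smulExtend φ φ.contMDiff hsupp)) x =
          d 0 V (g i) x := by
        refine d_congr (hVW i hxV) hxV ?_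
        filter_upwards [N.isOpen.mem_nhds hx] with z hz
        rw [restrict_apply _ _ (hVW i (hNV hz)), Form.smulExtend_apply, hNφ z hz, one_smul]
      have h2 : d 0 V (g i) x = (α i x - α o x) - (β i).1 x := by
        rw [hg]
        change (restrict 1 (hVW i) (α i) x - restrict 1 (hVW o) (α o) x) -
          restrict 1 (hVW i) (β i).1 x = _
        rw [restrict_apply _ _ hxV, restrict_apply _ _ hxV, restrict_apply _ _ hxV]
      change α i x - (β i).1 x - d 0 (W i) _ x = α o x
      rw [h1, h2]
      abel
    intro i j x hx
    exact (key i x hx).trans (key j x hx).symm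

end Gluing

/-- The complement of `f(X - W y)` is an open neighborhood of `y` over which the fibers lie in `W y`.
It contains the complement of `f(K)`, so finitely many of these sets that cover the compact set
`f(K)`, together with any one more, cover `Y`. -/
lemma exists_finset_cover_preimage_subset {X Y : Type*} [TopologicalSpace X] [TopologicalSpace Y]
    [T2Space Y] [Nonempty Y] {f : X → Y} (hf : Continuous f) {K : Set X} (hK : IsCompact K)
    {W : Y → Opens X} (hW : ∀ y, f ⁻¹' {y} ⊆ W y) (hKW : ∀ y, (W y : Set X)ᶜ ⊆ K) :
    ∃ (s : Finset Y) (U : Y → Set Y), (∀ y, IsOpen (U y)) ∧ (univ ⊆ ⋃ i : s, U i) ∧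
      ∀ y, f ⁻¹' (U y) ⊆ W y := by
  classical
  obtain ⟨o⟩ := ‹Nonempty Y›
  set U : Y → Set Y := fun y => (f '' (W y : Set X)ᶜ)ᶜ with hU
  have hUo : ∀ y, IsOpen (U y) := fun y =>
    ((hK.of_isClosed_subset (W y).isOpen.isClosed_compl (hKW y)).image hf).isClosed.isOpen_compl
  have hUy : ∀ y, y ∈ U y := by
    rintro y ⟨x, hx, rfl⟩
    exact hx (hW (f x) rfl)
  obtain ⟨t, ht⟩ := (hK.image hf).elim_finite_subcover U hUo
    fun y _ => mem_iUnion.2 ⟨y, hUy y⟩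
  refine ⟨insert o t, U, hUo, fun y _ => ?_, fun y x hx => ?_⟩
  · by_cases hy : y ∈ f '' K
    · obtain ⟨i, hi, hyi⟩ := mem_iUnion₂.1 (ht hy)
      exact mem_iUnion.2 ⟨⟨i, Finset.mem_insert_of_mem hi⟩, hyi⟩
    · exact mem_iUnion.2 ⟨⟨o, Finset.mem_insert_self o t⟩,
        fun h => hy (image_mono (hKW o) h)⟩
  · by_contra hxW
    exact hx ⟨x, hxW, rfl⟩

/-! ### The glued form -/

section Main

variable {E : Type*} [NormedAddCommGroup E] [NormedSpace ℝ E] [FiniteDimensional ℝ E]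
variable {F : Type*} [NormedAddCommGroup F] [NormedSpace ℝ F] [FiniteDimensional ℝ F]
variable {X : Type*} [TopologicalSpace X] [T2Space X] [SecondCountableTopology X]
  [ChartedSpace E X] [IsManifold 𝓘(ℝ, E) ∞ X]
variable {Y : Type*} [TopologicalSpace Y] [T2Space Y] [SecondCountableTopology Y]
  [ChartedSpace F Y] [IsManifold 𝓘(ℝ, F) ∞ Y]

/-- The glued form `ζ + dA` restricts to `ηV` near `C` and tames `J` on `ker df` everywhere. -/
theorem exists_closedForm_taming_ker [Nonempty Y] {f : X → Y}
    (hf : ContMDiff 𝓘(ℝ, E) 𝓘(ℝ, F) ∞ f) {C : Set X} (hC : IsClosed C)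
    (hcompact : IsCompact (interior C)ᶜ) {V : Opens X} (hCV : C ⊆ V) {J : AlmostComplex E X}
    (hJ : ∀ x, ∀ v ∈ (mfderiv 𝓘(ℝ, E) 𝓘(ℝ, F) f x).ker,
      J.toFun x v ∈ (mfderiv 𝓘(ℝ, E) 𝓘(ℝ, F) f x).ker)
    {W : Y → Opens X} (hW : ∀ y, f ⁻¹' {y} ⊆ W y) (hVW : ∀ y, V ≤ W y)
    (hH1 : ∀ y, Function.Surjective (HdR.restrict (E := E) 1 (hVW y)))
    {η : (y : Y) → closedForms E 2 (W y)} {ζ : closedForms E 2 (⊤ : Opens X)}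
    (hclass : ∀ y, HdR.mk (η y) = HdR.mk (restrictClosed 2 (le_top : W y ≤ ⊤) ζ))
    (htame : ∀ y, ∀ x ∈ W y,
      TamesOn J x ((η y).1 x) ((mfderiv 𝓘(ℝ, E) 𝓘(ℝ, F) f x).ker))
    {ηV : closedForms E 2 V} (hagree : ∀ y, restrictClosed 2 (hVW y) (η y) = ηV) :
    ∃ A : Form E 1 (⊤ : Opens X),
      (∀ᶠ x in 𝓝ˢ C, (ζ.1 + d 1 ⊤ A) x = ηV.1 x) ∧
      ∀ x, TamesOn J x ((ζ.1 + d 1 ⊤ A) x) ((mfderiv 𝓘(ℝ, E) 𝓘(ℝ, F) f x).ker) := by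
  have : LocallyCompactSpace Y := ChartedSpace.locallyCompactSpace F Y
  obtain ⟨α, N, hCN, hNV, hα, hαN⟩ := exists_compatible_primitives hC hCV hVW hH1 hclass hagree
  obtain ⟨s, U, hUo, hUc, hUW⟩ := exists_finset_cover_preimage_subset hf.continuous hcompact hW
    fun y => compl_subset_compl.2 (interior_subset.trans (hCV.trans (hVW y)))
  obtain ⟨ρ, hρ⟩ := SmoothPartitionOfUnity.exists_isSubordinate 𝓘(ℝ, F) isClosed_univ
    (fun i : s => U i) (fun i => hUo i) hUc
  set ψ : s → X → ℝ := fun i => ρ i ∘ f with hψ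
  have hψs : ∀ i, ContMDiff 𝓘(ℝ, E) 𝓘(ℝ, ℝ) ∞ (ψ i) := fun i => (ρ i).contMDiff.comp hf
  have hψW : ∀ i : s, tsupport (ψ i) ⊆ W i := fun i =>
    (tsupport_comp_subset_preimage (ρ i) hf.continuous).trans
      ((preimage_mono (hρ i)).trans (hUW i))
  have hψ1 : ∀ x, ∑ i, ψ i x = 1 := fun x => by
    rw [← ρ.sum_eq_one (mem_univ (f x)), finsum_eq_sum_of_fintype]
    rfl
  set A : Form E 1 (⊤ : Opens X) :=
    ∑ i : s, (α i).smulExtend (ψ i) (hψs i) (hψW i) with hA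
  refine ⟨A, ?_, fun x => ?_⟩
  · obtain ⟨o⟩ := ‹Nonempty Y›
    have hAN : ∀ x ∈ N, A x = α o x := fun x hx => by
      rw [hA, Form.sum_apply]
      simp only [Form.smulExtend_apply]
      rw [Finset.sum_congr rfl fun (i : s) _ => by rw [hαN i o x hx], ← Finset.sum_smul, hψ1,
        one_smul]
    filter_upwards [N.isOpen.mem_nhdsSet.2 hCN] with x hx
    have hxW := hVW o (hNV hx)
    have h1 : d 1 ⊤ A x = (η o).1 x - ζ.1 x := by
      rw [d_congr (show x ∈ (⊤ : Opens X) from trivial) hxW (eventually_of_mem (N.isOpen.mem_nhds hx) hAN), hα]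
      change (η o).1 x - restrict 2 le_top ζ.1 x = _
      rw [restrict_apply _ _ hxW]
    rw [Form.add_apply, h1, add_sub_cancel, ← hagree o]
    exact (restrict_apply (hVW o) _ (hNV hx)).symm
  · intro v hv hv0
    have hJv := hJ x v hv
    set w := J.toFun x v with hw
    -- `d(ρ i ∘ f)` vanishes on `ker df`, which contains both `v` and `Jv`.
    have hker : ∀ (i : s) (j : Fin 2), mfderiv 𝓘(ℝ, E) 𝓘(ℝ, ℝ) (ψ i) x (![v, w] j) = 0 := by
      intro i j
      have hc := mfderiv_comp x ((ρ i).contMDiff.mdifferentiable (by simp) (f x))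
        (hf.mdifferentiable (by simp) x)
      have hj : mfderiv 𝓘(ℝ, E) 𝓘(ℝ, F) f x (![v, w] j) = 0 := by
        fin_cases j
        · exact hv
        · exact hJv
      refine (DFunLike.congr_fun hc _).trans ?_
      change mfderiv 𝓘(ℝ, F) 𝓘(ℝ, ℝ) (ρ i) (f x) (mfderiv 𝓘(ℝ, E) 𝓘(ℝ, F) f x (![v, w] j)) = 0
      rw [hj, map_zero]
    have hdA : d 1 ⊤ A x ![v, w] = ∑ i : s, ψ i x * d 1 (W i) (α i) x ![v, w] := by
      rw [hA, map_sum, Form.sum_apply, ContinuousAlternatingMap.sum_apply]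
      exact Finset.sum_congr rfl fun i _ =>
        d_smulExtend_apply (hψs i) (hψW i) (α i) x _ (hker i)
    have hψ0 : ∀ i : s, x ∉ W i → ψ i x = 0 := fun i hi =>
      image_eq_zero_of_notMem_tsupport fun h => hi (hψW i h)
    -- If `x ∉ W i`, where `α i` and `η i` have junk values, both sides vanish since `ψ i x = 0`.
    have hterm : ∀ i : s, ψ i x * d 1 (W i) (α i) x ![v, w] =
        ψ i x * (η i).1 x ![v, w] - ψ i x * ζ.1 x ![v, w] := by
      intro i
      by_cases hi : x ∈ W i
      · have h : d 1 (W i) (α i) x = (η i).1 x - ζ.1 x := by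
          rw [hα]
          change (η i).1 x - restrict 2 le_top ζ.1 x = _
          rw [restrict_apply _ _ hi]
        rw [h, ContinuousAlternatingMap.sub_apply, mul_sub]
      · rw [hψ0 i hi]
        ring
    have htot : (ζ.1 + d 1 ⊤ A) x ![v, w] = ∑ i : s, ψ i x * (η i).1 x ![v, w] := by
      rw [Form.add_apply, ContinuousAlternatingMap.add_apply, hdA]
      simp only [hterm]
      rw [Finset.sum_sub_distrib, ← Finset.sum_mul, hψ1]
      ring
    rw [htot]
    have hpos : ∀ i : s, x ∈ W i → 0 < (η i).1 x ![v, w] := fun i hi => htame i x hi v hv hv0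
    obtain ⟨i₀, hi₀⟩ := ρ.exists_pos_of_mem (mem_univ (f x))
    refine Finset.sum_pos' (fun i _ => ?_) ⟨i₀, Finset.mem_univ _, ?_⟩
    · by_cases hi : x ∈ W i
      · exact mul_nonneg (ρ.nonneg i (f x)) (hpos i hi).le
      · rw [hψ0 i hi, zero_mul]
    · refine mul_pos hi₀ (hpos i₀ ?_)
      by_contra h
      exact hi₀.ne' (hψ0 i₀ h)

omit [T2Space X] [SecondCountableTopology X] [T2Space Y] [SecondCountableTopology Y]
  [FiniteDimensional ℝ F] in
lemma isSymplectic_smul_add_pullback {f : X → Y} (hf : ContMDiff 𝓘(ℝ, E) 𝓘(ℝ, F) ∞ f)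
    {σ : FormField F Y 2} (hσ : IsSymplectic σ) {J : AlmostComplex E X}
    (η : closedForms E 2 (⊤ : Opens X)) (t : ℝ)
    (h : ∀ x, TamesOn J x (t • η.1 x + pullback f σ x) ⊤) :
    IsSymplectic (E := E) (X := X) (fun x => t • η.1 x + pullback f σ x) := by
  obtain ⟨⟨hσs, hσc⟩, -⟩ := hσ
  have hps := pullback_mem_formSubmodule hf hσs
  have hmem : (fun x => t • η.1 x + pullback f σ x) ∈ formSubmodule 2 (⊤ : Opens X) :=
    (formSubmodule 2 ⊤).add_mem ((formSubmodule 2 ⊤).smul_mem t η.1.mem) hps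
  refine ⟨⟨hmem, ?_⟩, fun x v hv => (h x).eq_zero_of_forall hv⟩
  have heq : Form.mk _ hmem = t • η.1 + Form.mk _ hps := rfl
  rw [heq]
  exact (closedForms E 2 ⊤).add_mem ((closedForms E 2 ⊤).smul_mem t η.2)
    (d_pullback_eq_zero hf hσs hσc)

end Main

end GeomForms
end

open GeomForms in
theorem theorem3p1
    {E : Type*} [NormedAddCommGroup E] [NormedSpace ℝ E] [FiniteDimensional ℝ E]
    {F : Type*} [NormedAddCommGroup F] [NormedSpace ℝ F] [FiniteDimensional ℝ F]
    {X : Type*} [TopologicalSpace X] [T2Space X] [SecondCountableTopology X]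
    [ChartedSpace E X] [IsManifold 𝓘(ℝ, E) ∞ X]
    {Y : Type*} [TopologicalSpace Y] [T2Space Y] [SecondCountableTopology Y]
    [ChartedSpace F Y] [IsManifold 𝓘(ℝ, F) ∞ Y]
    (f : X → Y) (hf : ContMDiff 𝓘(ℝ, E) 𝓘(ℝ, F) ∞ f)
    (C : Set X) (hC : IsClosed C) (hcompact : IsCompact (interior C)ᶜ)
    (WC : Opens X) (hWC : C ⊆ WC)
    (ωY : FormField F Y 2) (hωY : IsSymplectic ωY)
    (J : AlmostComplex E X) (hJ : J.IsTame ωY f)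
    (c : HdR E 2 (⊤ : Opens X))
    (W : Y → Opens X) (hW : ∀ y, f ⁻¹' {y} ⊆ W y) (hWCW : ∀ y, WC ≤ W y)
    (hH1 : ∀ y, Function.Surjective (HdR.restrict (E := E) 1 (hWCW y)))
    (ηf : (y : Y) → closedForms E 2 (W y))
    (hclass : ∀ y, HdR.mk (ηf y) = HdR.restrict 2 (le_top : W y ≤ ⊤) c)
    (htame : ∀ y, ∀ x ∈ W y,
      TamesOn J x ((ηf y).1 x) ((mfderiv 𝓘(ℝ, E) 𝓘(ℝ, F) f x).ker))
    (ηC : closedForms E 2 WC)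
    (hagree : ∀ y, restrictClosed 2 (hWCW y) (ηf y) = ηC)
    (hηC : ∀ x ∈ C, TamesOn J x (ηC.1 x) ⊤) :
    ∃ η : closedForms E 2 (⊤ : Opens X),
      (∀ᶠ x in 𝓝ˢ C, η.1 x = ηC.1 x) ∧
      HdR.mk η = c ∧
      ∃ t₀ > 0, ∀ t : ℝ, 0 < t → t < t₀ →
        (∀ x, TamesOn J x (t • η.1 x + pullback f ωY x) ⊤) ∧
        IsSymplectic (E := E) (X := X) (fun x => t • η.1 x + pullback f ωY x) := by
  obtain ⟨ζ, rfl⟩ := Submodule.Quotient.mk_surjective _ c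
  -- Gluing needs a reference point of `Y`; if `Y` is empty, so is `X`.
  rcases isEmpty_or_nonempty Y with hY | hY
  · have hX : IsEmpty X := f.isEmpty
    exact ⟨ζ, Eventually.of_forall fun x => isEmptyElim x, rfl, 1, one_pos, fun t _ _ =>
      ⟨fun x => isEmptyElim x, isSymplectic_smul_add_pullback (J := J) hf hωY ζ t
        fun x => isEmptyElim x⟩⟩
  obtain ⟨A, hAC, hAker⟩ := exists_closedForm_taming_ker hf hC hcompact hWC
    (fun x v hv => hJ.map_mem_ker hv) hW hWCW hH1 (ζ := ζ) hclass htame hagree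
  set η : closedForms E 2 (⊤ : Opens X) := ζ + ⟨d 1 ⊤ A, d_d A⟩ with hη
  have hωs := pullback_mem_formSubmodule hf hωY.1.choose
  have hK := eventually_tamesOn_of_isCompact J η.1.mem hωs hJ.nonneg hcompact
    fun x _ v hv h0 => hAker x v (by
      by_contra hv'
      exact (hJ x v hv').ne' h0) hv
  obtain ⟨t₀, ht₀, hsub⟩ := mem_nhdsGT_iff_exists_Ioo_subset.1 hK
  refine ⟨η, hAC, ?_, t₀, ht₀, fun t ht htt => ?_⟩
  · refine (Submodule.Quotient.eq _).2 ?_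
    rw [hη, add_sub_cancel_left]
    exact ⟨A, rfl⟩
  have hall : ∀ x, TamesOn J x (t • η.1 x + pullback f ωY x) ⊤ := by
    intro x
    -- On `C` the form `η_C` tames `J`; the complement of `int C` is the compact set where `t < t₀`
    -- is needed.
    by_cases hx : x ∈ interior C
    · intro v hv hv0
      have hxC := interior_subset hx
      have heq : η.1 x = ηC.1 x := hAC.self_of_nhdsSet x hxC
      rw [heq]
      exact add_pos_of_pos_of_nonneg (mul_pos ht (hηC x hxC v hv hv0)) (hJ.nonneg x v)
    · exact hsub ⟨ht, htt⟩ x hx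
  exact ⟨hall, isSymplectic_smul_add_pullback hf hωY η t hall⟩
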